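/- Let $\mathrm{C}(x\mid y)$ denote plain conditional Kolmogorov complexity of binary strings with respect to a fixed optimal partial computable description mode $U$: $\mathrm{C}(x\mid y)$ is the least length of a program $p$ with $U(p,y)=x$, and optimality means that for every partial computable $D$ the complexity defined by $U$ exceeds the one defined by $D$ by at most an additive constant depending only on $D$. Put $\mathrm{dist}(x,y)=\max\{\mathrm{C}(x\mid y),\mathrm{C}(y\mid x)\}$. Logarithms are binary. **Theorem.** There is a constant $c$ (depending only on $U$) such that the following holds for every natural number $m$, every real $d$ and every set $S$ of binary strings. If $\mathrm{C}(x\mid x')\le m$ for all $x,x'\in S$ and $\#S\ge 2^{m-d}$ (that is, $\log \#S\ge m-d$), then there are a string $z$ and a natural number $k\le c\cdot(d+\log(m+2))$ such that $$\mathrm{C}(z\mid x)\le k\quad\text{and}\quad \mathrm{C}(x\mid z)\le m+k\qquad\text{for all } x\in S.$$ Rephrased: call $S$ an *$(m,\ell)$-cluster* if $\mathrm{dist}(x_1,x_2)\le m$ for all $x_1,x_2\in S$ and $\#S\ge 2^{\ell}$, and call $\{x : \mathrm{C}(z\mid x)\le d' \text{ and } \mathrm{C}(x\mid z)\le m'+d'\}$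 the *$(m',d')$-daisy with core $z$*. Then there is a constant $c$ such that for every natural number $m$ and real $d$, every $(m,m-d)$-cluster is contained in an $(m',d')$-daisy with some core $z$, for some natural numbers $m'\le m+c\cdot(d+\log(m+2))$ and $d'\le c\cdot(d+\log(m+2))$. -/

import Mathlib

open scoped ENNReal

/-- Binary strings. -/
abbrev BinStr : Type := List Bool

/-- `condC D x y` is the conditional complexity `C_D(x | y)` of `x` given `y` with respect to the
description mode `D`: the least length of a program `p` that outputs `x` on input `y`
(and `⊤` if there is no such program). -/
noncomputable def condC (D : BinStr → BinStr →. BinStr) (x y : BinStr) : ℕ∞ :=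
  ⨅ (p : BinStr) (_ : x ∈ D p y), (p.length : ℕ∞)

/-- An optimal description mode (optimal programming language) for conditional complexity:
it is partial computable, and up to an additive constant it is at least as good as any other
partial computable description mode. Plain Kolmogorov complexity `C(x | y)` is `condC U x y` for
a fixed optimal `U`. -/
def IsOptimal (U : BinStr → BinStr →. BinStr) : Prop :=
  Partrec₂ U ∧
    ∀ D : BinStr → BinStr →. BinStr, Partrec₂ D →
      ∃ c : ℕ, ∀ x y : BinStr, condC U x y ≤ condC D x y + c

/-- The information distance between `x` and `y`. -/
noncomputable def infoDist (U : BinStr → BinStr →. BinStr) (x y : BinStr) : ℕ∞ :=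
  max (condC U x y) (condC U y x)

/-- `S` is an `(m, l)`-cluster. -/
def IsCluster (U : BinStr → BinStr →. BinStr) (m : ℕ) (l : ℝ) (S : Set BinStr) : Prop :=
  (∀ x₁ ∈ S, ∀ x₂ ∈ S, infoDist U x₁ x₂ ≤ m) ∧ (2 : ℝ≥0∞) ^ l ≤ (S.encard : ℝ≥0∞)

/-- The `(m, d)`-daisy with the core `z`. -/
def daisy (U : BinStr → BinStr →. BinStr) (m d : ℕ) (z : BinStr) : Set BinStr :=
  {x | condC U z x ≤ d ∧ condC U x z ≤ m + d}

/-! With `e` the rounded-up `d`, enumerate all sets of `2 ^ (m - e)` strings whose mutual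
complexities are at most `m`, and keep a set only if it shares fewer than about `2 ^ (m - 2e - 3)`
elements with each set kept before. The given cluster then shares at least that many elements with
some kept set, whose code is the core `z` (`exists_mem_coreSet`).

Kept sets containing a fixed `x` all lie in the ball of the fewer than `2 ^ (m + 1)` strings of
complexity at most `m` given `x`. They are almost disjoint, so there are fewer than `2 ^ (e + 2)` of
them (`card_lt_of_mem_coreSet`).

Every `x` in the cluster is close to all its elements, hence to many elements of `z`. Double
counting shows that at most `2 ^ (3e + 6)` kept sets meet the ball of `x` this heavily
(`card_le_of_coreTest`), and that at most `2 ^ (m + e + 4)` strings are close to that many elements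
of `z` (`card_le_of_petalTest`). Both conditions are semidecidable, so an index in an enumeration,
together with `m` and `e`, describes `z` given `x` and `x` given `z` (`IsOptimal.exists_condC_le`).
-/

open Encodable Nat.Partrec

/-! ### Greedy selection along an enumeration -/

section Greedy

variable {α : Type*} [Encodable α]

open Classical in
/-- Scan all elements `a` of `α` in the order of their codes, and keep `a` if it satisfies `P` and
is `R`-related to everything kept before. -/
noncomputable def greedy (P : α → Prop) (R : α → α → Prop) (t : ℕ) : List α :=
  Nat.rec [] (fun t l => Option.casesOn (decode t : Option α) l fun a =>
    if P a ∧ ∀ b ∈ l, R b a then l ++ [a] else l) t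

variable {P : α → Prop} {R : α → α → Prop}

open Classical in
theorem greedy_succ_of_decode {t : ℕ} {a : α} (h : decode t = some a) : greedy P R (t + 1) =
    if P a ∧ ∀ b ∈ greedy P R t, R b a then greedy P R t ++ [a] else greedy P R t := by
  simp only [greedy, h]
  congr

theorem greedy_succ (t : ℕ) : greedy P R (t + 1) = greedy P R t ∨
    ∃ a, P a ∧ (∀ b ∈ greedy P R t, R b a) ∧ greedy P R (t + 1) = greedy P R t ++ [a] := by
  rcases h : (decode t : Option α) with _ | a
  · left; simp only [greedy, h]
  · rw [greedy_succ_of_decode h]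
    split_ifs with hp
    · exact Or.inr ⟨a, hp.1, hp.2, rfl⟩
    · exact Or.inl rfl

/-- Elements are only appended, so an index found at one step stays valid at all later ones. -/
theorem greedy_prefix {s t : ℕ} (h : s ≤ t) : greedy P R s <+: greedy P R t := by
  induction t, h using Nat.le_induction with
  | base => exact List.prefix_rfl
  | succ t _ ih =>
    rcases greedy_succ (P := P) (R := R) t with h | ⟨a, -, -, h⟩
    · rwa [h]
    · rw [h]; exact ih.trans (List.prefix_append _ _)

theorem greedy_spec (t : ℕ) :
    (∀ a ∈ greedy P R t, P a) ∧ (greedy P R t).Pairwise R := by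
  induction t with
  | zero => simp [greedy]
  | succ t ih =>
    rcases greedy_succ (P := P) (R := R) t with h | ⟨a, ha, hb, h⟩
    · rwa [h]
    · rw [h]
      refine ⟨fun b hm => ?_, ?_⟩
      · rcases List.mem_append.1 hm with hm | hm
        · exact ih.1 b hm
        · rw [List.mem_singleton.1 hm]; exact ha
      · rw [List.pairwise_append]
        refine ⟨ih.2, List.pairwise_singleton _ _, fun b hm c hc => ?_⟩
        rw [List.mem_singleton.1 hc]
        exact hb b hm

/-- The element `a` is examined at step `encode a`; it can be turned down only because of some `b`
already kept. -/
theorem exists_mem_greedy {a : α} (ha : P a) :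
    ∃ t, ∃ b ∈ greedy P R t, b = a ∨ ¬ R b a := by
  classical
  by_cases h : ∀ b ∈ greedy P R (encode a), R b a
  · refine ⟨encode a + 1, a, ?_, Or.inl rfl⟩
    rw [greedy_succ_of_decode (encodek a), if_pos ⟨ha, h⟩]
    simp
  · push Not at h
    obtain ⟨b, hb, hr⟩ := h
    exact ⟨_, b, hb, Or.inr hr⟩

end Greedy

theorem primrec_greedy {σ α : Type*} [Primcodable σ] [Primcodable α] {P : σ → α → Prop}
    {R : σ → α → α → Prop} (hP : PrimrecRel P)
    (hR : PrimrecRel fun (b : α) (q : σ × α) => R q.1 b q.2) :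
    Primrec₂ fun s t => greedy (P s) (R s) t := by
  classical
  suffices step : Primrec₂ fun (s : σ) (q : ℕ × List α) =>
      (Option.casesOn (decode q.1 : Option α) q.2 fun a =>
        if P s a ∧ ∀ b ∈ q.2, R s b a then q.2 ++ [a] else q.2 : List α) by
    refine (Primrec.nat_rec (Primrec.const ([] : List α)) step).of_eq fun s t => ?_
    simp only [greedy]
  refine (Primrec.option_casesOn (o := fun q : σ × ℕ × List α => (decode q.2.1 : Option α))
    (f := fun q => q.2.2)
    (g := fun q a => if P q.1 a ∧ ∀ b ∈ q.2.2, R q.1 b a then q.2.2 ++ [a] else q.2.2)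
    (Primrec.decode.comp (Primrec.fst.comp Primrec.snd)) (Primrec.snd.comp Primrec.snd) ?_).to₂
  refine Primrec.ite (c := fun r : (σ × ℕ × List α) × α =>
    P r.1.1 r.2 ∧ ∀ b ∈ r.1.2.2, R r.1.1 b r.2) ?_ ?_ ?_
  · refine PrimrecPred.and (hP.comp (Primrec.fst.comp Primrec.fst) Primrec.snd) ?_
    exact hR.forall_mem_list.comp (Primrec.snd.comp (Primrec.snd.comp Primrec.fst))
      ((Primrec.fst.comp Primrec.fst).pair Primrec.snd)
  · exact Primrec.list_concat.comp (Primrec.snd.comp (Primrec.snd.comp Primrec.fst)) Primrec.snd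
  · exact Primrec.snd.comp (Primrec.snd.comp Primrec.fst)

/-! ### Programs carrying two parameters and an index -/

theorem primrec_pow : Primrec₂ ((· ^ ·) : ℕ → ℕ → ℕ) :=
  Primrec₂.unpaired'.1 Nat.Primrec.pow

/-- Split `1ⁿ0r` into `n` and `r`. -/
def splitUnary (p : BinStr) : ℕ × BinStr :=
  ((p.takeWhile id).length, (p.dropWhile id).tail)

theorem splitUnary_replicate (n : ℕ) (r : BinStr) :
    splitUnary (List.replicate n true ++ false :: r) = (n, r) := by
  induction n with
  | zero => simp [splitUnary]
  | succ n ih =>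
    simp only [splitUnary, Prod.mk.injEq] at ih
    simp [splitUnary, List.replicate_succ]

theorem primrec_splitUnary : Primrec splitUnary :=
  (Primrec.list_length.comp (Primrec.list_takeWhile Primrec.id)).pair
    (Primrec.list_tail.comp (Primrec.list_dropWhile Primrec.id))

/-- The number with the given binary digits, least significant first. -/
def binValue (p : BinStr) : ℕ :=
  p.foldr (fun b n => 2 * n + b.toNat) 0

theorem binValue_bits (n : ℕ) : binValue n.bits = n := by
  induction n using Nat.binaryRec' with
  | zero => simp [binValue]
  | bit b n h ih =>
    rw [Nat.bits_append_bit _ _ h]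
    simp only [binValue, List.foldr_cons] at ih ⊢
    rw [ih, Nat.bit_val]

theorem primrec_binValue : Primrec binValue := by
  refine Primrec.list_foldr (h := fun (_ : BinStr) (q : Bool × ℕ) => 2 * q.2 + q.1.toNat)
    Primrec.id (Primrec.const 0) ?_
  exact Primrec.nat_add.comp
    (Primrec.nat_mul.comp (Primrec.const 2) (Primrec.snd.comp Primrec.snd))
    ((Primrec.dom_bool Bool.toNat).comp (Primrec.fst.comp Primrec.snd))

/-- The program `1ᵉ01ʲ0v`, where `j` is the length of `m` in binary and `v` is the binary notation
of `i * 2 ^ j + m`. -/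
def paramProgram (m e i : ℕ) : BinStr :=
  List.replicate e true ++ false ::
    (List.replicate m.size true ++ false :: (i * 2 ^ m.size + m).bits)

theorem length_paramProgram_le {m e i b : ℕ} (h : i < 2 ^ b) :
    (paramProgram m e i).length ≤ b + e + 2 * m.size + 2 := by
  have : (i * 2 ^ m.size + m).bits.length ≤ b + m.size := by
    rw [Nat.size_eq_bits_len, Nat.size_le, pow_add]
    have h1 := Nat.lt_size_self m
    have h2 : (i + 1) * 2 ^ m.size ≤ 2 ^ b * 2 ^ m.size := Nat.mul_le_mul_right _ h
    linarith
  simp [paramProgram]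
  omega

/-- The inverse of `paramProgram`. -/
def readParams (p : BinStr) : (ℕ × ℕ) × ℕ :=
  let r := splitUnary p
  let r' := splitUnary r.2
  ((binValue r'.2 % 2 ^ r'.1, r.1), binValue r'.2 / 2 ^ r'.1)

theorem readParams_paramProgram (m e i : ℕ) :
    readParams (paramProgram m e i) = ((m, e), i) := by
  have h := Nat.lt_size_self m
  simp only [readParams, paramProgram, splitUnary_replicate, binValue_bits, Prod.mk.injEq, and_true]
  constructor
  · rw [mul_comm, Nat.mul_add_mod, Nat.mod_eq_of_lt h]
  · rw [mul_comm, Nat.mul_add_div (by positivity), Nat.div_eq_of_lt h, add_zero]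

theorem primrec_readParams : Primrec readParams := by
  have h1 := primrec_splitUnary
  have h2 := h1.comp (Primrec.snd.comp h1)
  have hv := primrec_binValue.comp (Primrec.snd.comp h2)
  have hp := primrec_pow.comp (Primrec.const 2) (Primrec.fst.comp h2)
  exact ((Primrec.nat_mod.comp hv hp).pair (Primrec.fst.comp h1)).pair (Primrec.nat_div.comp hv hp)

/-! ### Describing a string by its index in an enumeration -/

section Describe

variable (T : (ℕ × ℕ) × BinStr → BinStr × ℕ → Prop)

/-- The enumeration without repetitions of all `x` such that `T s (x, w)` for some `w`. -/
noncomputable def enumeration (s : (ℕ × ℕ) × BinStr) (t : ℕ) : List (BinStr × ℕ) :=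
  greedy (T s) (fun b a => b.1 ≠ a.1) t

/-- The description mode in which `x` is described by the parameters and its index in the
enumeration defined by `T`. -/
noncomputable def enumMode (p y : BinStr) : Part BinStr :=
  Nat.rfindOpt fun t =>
    ((enumeration T ((readParams p).1, y) t)[(readParams p).2]?).map Prod.fst

variable {T}

theorem partrec_enumMode (hT : PrimrecRel T) : Partrec₂ (enumMode T) := by
  have hg : Primrec₂ (enumeration T) := by
    refine primrec_greedy hT (R := fun _ b a => b.1 ≠ a.1) ?_
    exact PrimrecPred.not (Primrec.eq.comp (Primrec.fst.comp Primrec.fst)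
      (Primrec.fst.comp (Primrec.snd.comp Primrec.snd)))
  refine Partrec.rfindOpt (f := fun (q : BinStr × BinStr) t =>
    ((enumeration T ((readParams q.1).1, q.2) t)[(readParams q.1).2]?).map Prod.fst)
    (Primrec.to_comp ?_)
  have hr : Primrec fun q : (BinStr × BinStr) × ℕ => readParams q.1.1 :=
    primrec_readParams.comp (Primrec.fst.comp Primrec.fst)
  refine Primrec.option_map (Primrec.list_getElem?.comp (hg.comp
    ((Primrec.fst.comp hr).pair (Primrec.snd.comp Primrec.fst)) Primrec.snd)
    (Primrec.snd.comp hr)) ?_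
  exact (Primrec.fst.comp Primrec.snd).to₂

/-- The enumerated strings are distinct and all pass the test, so no list in the enumeration is
longer than `N`. -/
theorem exists_index_of_card_le {s : (ℕ × ℕ) × BinStr} {N : ℕ}
    (hN : ∀ A : Finset BinStr, (∀ x ∈ A, ∃ w, T s (x, w)) → A.card ≤ N)
    {x : BinStr} (hx : ∃ w, T s (x, w)) :
    ∃ i < N, ∃ t w, (enumeration T s t)[i]? = some (x, w) := by
  obtain ⟨w, hw⟩ := hx
  obtain ⟨t, b, hb, hbx⟩ := exists_mem_greedy (R := fun b a : BinStr × ℕ => b.1 ≠ a.1) hw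
  have hbx : b.1 = x := by
    rcases hbx with rfl | h
    · rfl
    · simpa using h
  obtain ⟨i, hi⟩ := List.mem_iff_getElem?.1 hb
  refine ⟨i, ?_, t, b.2, ?_⟩
  · have hs := greedy_spec (P := T s) (R := fun b a : BinStr × ℕ => b.1 ≠ a.1) t
    have hnd : ((enumeration T s t).map Prod.fst).Nodup := by
      rw [List.Nodup, List.pairwise_map]; exact hs.2
    have := hN ((enumeration T s t).map Prod.fst).toFinset (by
      intro y hy
      simp only [List.mem_toFinset, List.mem_map] at hy
      obtain ⟨a, ha, rfl⟩ := hy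
      exact ⟨a.2, hs.1 a ha⟩)
    rw [List.toFinset_card_of_nodup hnd, List.length_map] at this
    obtain ⟨hlt, -⟩ := List.getElem?_eq_some_iff.1 hi
    exact hlt.trans_le this
  · rw [← hbx]; exact hi

theorem mem_enumMode {m e i t w : ℕ} {x y : BinStr}
    (h : (enumeration T ((m, e), y) t)[i]? = some (x, w)) :
    x ∈ enumMode T (paramProgram m e i) y := by
  rw [enumMode, readParams_paramProgram]
  refine (Nat.rfindOpt_mono ?_).2 ⟨t, by simp [h]⟩
  intro a k l hkl ha
  simp only [Option.mem_def, Option.map_eq_some_iff] at ha ⊢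
  obtain ⟨b, hb, rfl⟩ := ha
  refine ⟨b, ?_, rfl⟩
  obtain ⟨r, hr⟩ := greedy_prefix (P := T ((m, e), y)) (R := fun b a => b.1 ≠ a.1) hkl
  rw [enumeration, ← hr]
  exact (List.getElem?_append_left (List.getElem?_eq_some_iff.1 hb).1).trans hb

theorem condC_le_length {D : BinStr → BinStr →. BinStr} {p x y : BinStr} (h : x ∈ D p y) :
    condC D x y ≤ p.length :=
  iInf₂_le p h

/-- If for given `(m, e)` and `y` at most `2 ^ b` strings pass a semidecidable test, then each of
them has complexity at most `b` given `y`, up to the cost of specifying `m` and `e`. -/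
theorem IsOptimal.exists_condC_le {U : BinStr → BinStr →. BinStr} (hU : IsOptimal U)
    (hT : PrimrecRel T) :
    ∃ c : ℕ, ∀ (m e b : ℕ) (y : BinStr),
      (∀ A : Finset BinStr, (∀ x ∈ A, ∃ w, T ((m, e), y) (x, w)) → A.card ≤ 2 ^ b) →
      ∀ x, (∃ w, T ((m, e), y) (x, w)) →
        condC U x y ≤ ((b + e + 2 * m.size + c : ℕ) : ℕ∞) := by
  obtain ⟨c, hc⟩ := hU.2 _ (partrec_enumMode hT)
  refine ⟨c + 2, fun m e b y hA x hx => ?_⟩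
  obtain ⟨i, hi, t, w, h⟩ := exists_index_of_card_le hA hx
  calc condC U x y ≤ condC (enumMode T) x y + c := hc x y
    _ ≤ ((paramProgram m e i).length : ℕ∞) + c := by gcongr; exact condC_le_length (mem_enumMode h)
    _ ≤ ((b + e + 2 * m.size + 2 : ℕ) : ℕ∞) + c := by
        gcongr; exact length_paramProgram_le hi
    _ = _ := by norm_cast; ring_nf

end Describe

/-! ### Counting -/

section Counting

variable {α ι : Type*} [DecidableEq α]

/-- Each overlap is at most `M / (2N)` and there are at most `N` sets, so every new set has at most
`M / 2` elements already covered and adds at least `M / 2` new ones. -/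
theorem card_mul_le_two_mul_card_biUnion {F : ι → Finset α} {M N : ℕ} {I : Finset ι}
    (hM : ∀ i ∈ I, M ≤ (F i).card)
    (hF : ∀ i ∈ I, ∀ j ∈ I, i ≠ j → 2 * N * (F i ∩ F j).card ≤ M) (hI : I.card ≤ N) :
    I.card * M ≤ 2 * (I.biUnion F).card := by
  classical
  induction I using Finset.induction_on with
  | empty => simp
  | insert a s ha ih =>
    rw [Finset.card_insert_of_notMem ha] at hI ⊢
    have ih := ih (fun i hi => hM i (Finset.mem_insert_of_mem hi))
      (fun i hi j hj => hF i (Finset.mem_insert_of_mem hi) j (Finset.mem_insert_of_mem hj))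
      (by omega)
    have h1 : (F a ∩ s.biUnion F).card ≤ ∑ i ∈ s, (F a ∩ F i).card := by
      rw [Finset.inter_biUnion]
      exact Finset.card_biUnion_le
    have h2 : 2 * N * ∑ i ∈ s, (F a ∩ F i).card ≤ s.card * M := by
      rw [Finset.mul_sum, ← smul_eq_mul (s.card)]
      refine Finset.sum_le_card_nsmul _ _ _ fun i hi => ?_
      refine hF a (Finset.mem_insert_self _ _) i (Finset.mem_insert_of_mem hi) ?_
      rintro rfl
      exact ha hi
    have h3 : 2 * (F a ∩ s.biUnion F).card ≤ M := by
      have : N * (2 * (F a ∩ s.biUnion F).card) ≤ N * M := by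
        calc N * (2 * (F a ∩ s.biUnion F).card) = 2 * N * (F a ∩ s.biUnion F).card := by ring
          _ ≤ 2 * N * ∑ i ∈ s, (F a ∩ F i).card := by gcongr
          _ ≤ s.card * M := h2
          _ ≤ N * M := by gcongr; omega
      exact Nat.le_of_mul_le_mul_left this (by omega)
    have h4 := Finset.card_union_add_card_inter (F a) (s.biUnion F)
    have h5 := hM a (Finset.mem_insert_self _ _)
    rw [Finset.biUnion_insert]
    nlinarith

theorem card_lt_of_biUnion_subset {F : ι → Finset α} {M N : ℕ} {I : Finset ι} {B : Finset α}
    (hM : ∀ i ∈ I, M ≤ (F i).card)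
    (hF : ∀ i ∈ I, ∀ j ∈ I, i ≠ j → 2 * N * (F i ∩ F j).card ≤ M)
    (hB : ∀ i ∈ I, F i ⊆ B) (hN : 2 * B.card < N * M) : I.card < N := by
  by_contra! h
  -- Exactly `N` of the sets are retained, as the overlap bound is calibrated for at most `N` sets.
  obtain ⟨J, hJ, rfl⟩ := Finset.exists_subset_card_eq h
  have h1 := card_mul_le_two_mul_card_biUnion (fun i hi => hM i (hJ hi))
    (fun i hi j hj => hF i (hJ hi) j (hJ hj)) le_rfl
  have h2 : (J.biUnion F).card ≤ B.card :=
    Finset.card_le_card (Finset.biUnion_subset.2 fun i hi => hB i (hJ hi))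
  omega

end Counting

/-! ### Strings of small complexity -/

theorem condC_le_iff {D : BinStr → BinStr →. BinStr} {x y : BinStr} {m : ℕ} :
    condC D x y ≤ m ↔ ∃ p : BinStr, p.length ≤ m ∧ x ∈ D p y := by
  constructor
  · intro h
    have h : condC D x y < ((m + 1 : ℕ) : ℕ∞) :=
      h.trans_lt (by exact_mod_cast Nat.lt_succ_self m)
    simp only [condC, iInf_lt_iff] at h
    obtain ⟨p, hp, hl⟩ := h
    exact ⟨p, Nat.lt_succ_iff.1 (by exact_mod_cast hl), hp⟩
  · rintro ⟨p, hl, hp⟩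
    exact (condC_le_length hp).trans (by exact_mod_cast hl)

theorem exists_finset_length_le (m : ℕ) :
    ∃ P : Finset BinStr, (∀ p : BinStr, p.length ≤ m → p ∈ P) ∧ P.card < 2 ^ (m + 1) := by
  induction m with
  | zero => exact ⟨{[]}, by simp, by simp⟩
  | succ m ih =>
    obtain ⟨P, hP, hc⟩ := ih
    refine ⟨P ∪ (Finset.univ : Finset (List.Vector Bool (m + 1))).image List.Vector.toList,
      fun p hp => ?_, ?_⟩
    · rcases hp.lt_or_eq with h | h
      · exact Finset.mem_union_left _ (hP p (by omega))
      · refine Finset.mem_union_right _ (Finset.mem_image.2 ⟨⟨p, h⟩, Finset.mem_univ _, rfl⟩)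
    · have h1 := Finset.card_union_le P
        ((Finset.univ : Finset (List.Vector Bool (m + 1))).image List.Vector.toList)
      have h2 : ((Finset.univ : Finset (List.Vector Bool (m + 1))).image
          List.Vector.toList).card ≤ 2 ^ (m + 1) :=
        Finset.card_image_le.trans (by simp)
      rw [pow_succ 2 (m + 1)]
      omega

theorem exists_finset_condC_le (D : BinStr → BinStr →. BinStr) (m : ℕ) (y : BinStr) :
    ∃ B : Finset BinStr, (∀ x, condC D x y ≤ m → x ∈ B) ∧ B.card < 2 ^ (m + 1) := by
  classical
  obtain ⟨P, hP, hc⟩ := exists_finset_length_le m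
  refine ⟨(P.image fun p => (D p y).toOption).eraseNone, fun x hx => ?_, ?_⟩
  · obtain ⟨p, hl, hp⟩ := condC_le_iff.1 hx
    rw [Finset.mem_eraseNone, Finset.mem_image]
    exact ⟨p, hP p hl, Part.mem_toOption.2 hp⟩
  · exact ((Finset.card_eraseNone_le _).trans Finset.card_image_le).trans_lt hc

theorem exists_code_mem_iff {U : BinStr → BinStr →. BinStr} (hU : Partrec₂ U) :
    ∃ c : Code, ∀ p y x, x ∈ U p y ↔ encode x ∈ c.eval (encode (p, y)) := by
  obtain ⟨c, hc⟩ := Code.exists_code.1 hU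
  refine ⟨c, fun p y x => ?_⟩
  rw [hc]
  simp [encode_inj]

/-- Within `w` steps, a program of length at most `m` is found that outputs `x` on input `y`. -/
def FoundWithin (c : Code) (w m : ℕ) (x y : BinStr) : Prop :=
  ∃ p ∈ (List.range w).filterMap (decode : ℕ → Option BinStr),
    p.length ≤ m ∧ Code.evaln w c (encode (p, y)) = some (encode x)

/-- Monotonicity lets finitely many searches share one time bound. -/
theorem FoundWithin.mono {c : Code} {w w' m : ℕ} {x y : BinStr} (h : w ≤ w')
    (hf : FoundWithin c w m x y) : FoundWithin c w' m x y := by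
  obtain ⟨p, hp, hl, he⟩ := hf
  simp only [List.mem_filterMap, List.mem_range] at hp
  obtain ⟨n, hn, hd⟩ := hp
  refine ⟨p, ?_, hl, Code.evaln_mono h he⟩
  simp only [List.mem_filterMap, List.mem_range]
  exact ⟨n, hn.trans_le h, hd⟩

theorem exists_foundWithin_iff {U : BinStr → BinStr →. BinStr} {c : Code}
    (hc : ∀ p y x, x ∈ U p y ↔ encode x ∈ c.eval (encode (p, y))) {m : ℕ} {x y : BinStr} :
    (∃ w, FoundWithin c w m x y) ↔ condC U x y ≤ m := by
  rw [condC_le_iff]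
  constructor
  · rintro ⟨w, p, -, hl, he⟩
    exact ⟨p, hl, (hc _ _ _).2 (Code.evaln_sound he)⟩
  · rintro ⟨p, hl, hp⟩
    obtain ⟨k, hk⟩ := Code.evaln_complete.1 ((hc _ _ _).1 hp)
    refine ⟨max k (encode p + 1), p, ?_, hl, Code.evaln_mono (le_max_left _ _) hk⟩
    simp only [List.mem_filterMap, List.mem_range]
    exact ⟨encode p, by omega, encodek p⟩

theorem primrecPred_foundWithin (c : Code) :
    PrimrecPred fun q : (ℕ × ℕ) × BinStr × BinStr => FoundWithin c q.1.1 q.1.2 q.2.1 q.2.2 := by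
  have h : PrimrecRel fun (p : BinStr) (q : (ℕ × ℕ) × BinStr × BinStr) =>
      p.length ≤ q.1.2 ∧ Code.evaln q.1.1 c (encode (p, q.2.2)) = some (encode q.2.1) := by
    refine PrimrecPred.and (Primrec.nat_le.comp (Primrec.list_length.comp Primrec.fst)
      (Primrec.snd.comp (Primrec.fst.comp Primrec.snd))) ?_
    refine Primrec.eq.comp (Code.primrec_evaln.comp
      (((Primrec.fst.comp (Primrec.fst.comp Primrec.snd)).pair (Primrec.const c)).pair
      (Primrec.encode.comp (Primrec.fst.pair (Primrec.snd.comp (Primrec.snd.comp Primrec.snd))))))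
      (Primrec.option_some.comp (Primrec.encode.comp
        (Primrec.fst.comp (Primrec.snd.comp Primrec.snd))))
  refine h.exists_mem_list.comp (f := fun q : (ℕ × ℕ) × BinStr × BinStr =>
    (List.range q.1.1).filterMap (decode : ℕ → Option BinStr)) ?_ Primrec.id
  exact Primrec.listFilterMap (Primrec.list_range.comp (Primrec.fst.comp Primrec.fst))
    (Primrec.decode.comp Primrec.snd).to₂

theorem primrecPred_nodup {α : Type*} [Primcodable α] :
    PrimrecPred fun l : List α => l.Nodup := by
  classical
  have h1 : Primrec₂ fun (l : List α) (x : α) => l.filter (fun a => a = x) :=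
    PrimrecRel.listFilter Primrec.eq
  have h2 : PrimrecRel fun (x : α) (l : List α) => (l.filter (fun a => a = x)).length ≤ 1 :=
    Primrec.nat_le.comp (Primrec.list_length.comp (h1.comp Primrec.snd Primrec.fst))
      (Primrec.const 1)
  refine (h2.forall_mem_list.comp Primrec.id Primrec.id).of_eq fun l => ?_
  have hcount : ∀ a, (l.filter (fun b => b = a)).length = l.count a := fun a => by
    simp [List.count_eq_length_filter, beq_eq_decide]
  simp only [id, hcount, List.nodup_iff_count_le_one]
  refine ⟨fun h a => ?_, fun h a _ => h a⟩
  by_cases ha : a ∈ l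
  · exact h a ha
  · rw [List.count_eq_zero_of_not_mem ha]
    exact zero_le_one

/-! ### Selected clusters -/

/-- The list of strings coded by the string `z`. -/
def listOf (z : BinStr) : List BinStr :=
  (decode z.length : Option (List BinStr)).getD []

theorem primrec_listOf : Primrec listOf :=
  Primrec.option_getD.comp (Primrec.decode.comp Primrec.list_length) (Primrec.const [])

theorem exists_listOf_eq (l : List BinStr) : ∃ z, listOf z = l :=
  ⟨List.replicate (encode l) true, by simp [listOf]⟩

/-- The overlap that two clusters of size `2 ^ (m - e)` must have to count as similar. -/
def overlap (s : ℕ × ℕ) : ℕ := 2 ^ (s.1 - (2 * s.2 + 3))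

theorem primrec_overlap : Primrec overlap :=
  primrec_pow.comp (Primrec.const 2) (Primrec.nat_sub.comp Primrec.fst
    (Primrec.nat_add.comp (Primrec.nat_mul.comp (Primrec.const 2) Primrec.snd) (Primrec.const 3)))

theorem mul_le_of_lt_overlap {m e k : ℕ} (he : e ≤ m) (h : k < overlap (m, e)) :
    2 * 2 ^ (e + 2) * k ≤ 2 ^ (m - e) := by
  simp only [overlap] at h
  -- Otherwise the subtraction truncates, the threshold is `1`, and `k` must be `0`.
  by_cases hm : 2 * e + 3 ≤ m
  · calc 2 * 2 ^ (e + 2) * k ≤ 2 * 2 ^ (e + 2) * 2 ^ (m - (2 * e + 3)) := by gcongr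
      _ = 2 ^ (1 + (e + 2) + (m - (2 * e + 3))) := by simp only [pow_add, pow_one]
      _ = 2 ^ (m - e) := by congr 1; omega
  · rw [Nat.sub_eq_zero_of_le (by omega)] at h
    have : k = 0 := by simpa using h
    simp [this]

/-- Truncated subtraction can only enlarge the threshold, so no assumption on `e` is needed. -/
theorem two_pow_le_mul_overlap (m e : ℕ) : 2 ^ m ≤ 2 ^ (2 * e + 3) * overlap (m, e) := by
  rw [overlap, ← pow_add]
  exact Nat.pow_le_pow_right (by norm_num) (by simp only; omega)

theorem overlap_le (m e : ℕ) : overlap (m, e) ≤ 2 ^ (m - e) :=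
  Nat.pow_le_pow_right (by norm_num) (by simp only; omega)

/-- `z` codes a set of `2 ^ (m - e)` strings that are found to be of complexity at most `m` given
each other, within `w` steps. -/
def CodesCluster (c : Code) (s : ℕ × ℕ) (a : BinStr × ℕ) : Prop :=
  (listOf a.1).length = 2 ^ (s.1 - s.2) ∧ (listOf a.1).Nodup ∧
    ∀ x ∈ listOf a.1, ∀ y ∈ listOf a.1, FoundWithin c a.2 s.1 x y

/-- The sets coded by `a` and `b` are not similar. -/
def SmallOverlap (s : ℕ × ℕ) (b a : BinStr × ℕ) : Prop :=
  ((listOf a.1).filter (· ∈ listOf b.1)).length < overlap s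

/-- The codes of clusters selected up to step `t`. -/
noncomputable def selected (c : Code) (s : ℕ × ℕ) (t : ℕ) : List (BinStr × ℕ) :=
  greedy (CodesCluster c s) (SmallOverlap s) t

/-- The codes of selected clusters. -/
def coreSet (c : Code) (s : ℕ × ℕ) : Set BinStr :=
  {z | ∃ t, ∃ b ∈ selected c s t, b.1 = z}

open Classical in
/-- The elements of the set coded by `z` that satisfy `p` are not few. -/
def IsHeavy (s : ℕ × ℕ) (p : BinStr → Prop) (z : BinStr) : Prop :=
  overlap s ≤ ((listOf z).filter (p ·)).length

/-- The test for `z` being a candidate core of a daisy containing `x`. -/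
def CoreTest (c : Code) (s : (ℕ × ℕ) × BinStr) (a : BinStr × ℕ) : Prop :=
  (∃ b ∈ selected c s.1 a.2, b.1 = a.1) ∧
    IsHeavy s.1 (fun y => FoundWithin c a.2 s.1.1 y s.2) a.1

/-- The test for `x` being in the daisy with the core `z`. -/
def PetalTest (c : Code) (s : (ℕ × ℕ) × BinStr) (a : BinStr × ℕ) : Prop :=
  ((listOf s.2).length = 2 ^ (s.1.1 - s.1.2) ∧ (listOf s.2).Nodup) ∧
    IsHeavy s.1 (fun y => FoundWithin c a.2 s.1.1 a.1 y) s.2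

/-! ### Primitive recursiveness of the tests -/

section Primrec

variable {σ : Type*} [Primcodable σ]

theorem PrimrecRel.isHeavy {R : BinStr → σ → Prop} (hR : PrimrecRel R) {s : σ → ℕ × ℕ}
    {z : σ → BinStr} (hs : Primrec s) (hz : Primrec z) :
    PrimrecPred fun q : σ => IsHeavy (s q) (fun y => R y q) (z q) := by
  classical
  have h : Primrec fun q : σ => ((listOf (z q)).filter (fun y => R y q)).length :=
    Primrec.list_length.comp (hR.listFilter.comp (primrec_listOf.comp hz) Primrec.id)
  refine (Primrec.nat_le.comp (primrec_overlap.comp hs) h).of_eq fun q => ?_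
  simp only [IsHeavy]

theorem primrecRel_codesCluster (c : Code) : PrimrecRel (CodesCluster c) := by
  have hl : Primrec fun q : (ℕ × ℕ) × (BinStr × ℕ) => listOf q.2.1 :=
    primrec_listOf.comp (Primrec.fst.comp Primrec.snd)
  have h1 : PrimrecRel fun (y : BinStr) (q : BinStr × (ℕ × ℕ) × (BinStr × ℕ)) =>
      FoundWithin c q.2.2.2 q.2.1.1 q.1 y :=
    (primrecPred_foundWithin c).comp
      (((Primrec.snd.comp (Primrec.snd.comp (Primrec.snd.comp Primrec.snd))).pair
        (Primrec.fst.comp (Primrec.fst.comp (Primrec.snd.comp Primrec.snd)))).pair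
        ((Primrec.fst.comp Primrec.snd).pair Primrec.fst))
  have h2 : PrimrecRel fun (x : BinStr) (q : (ℕ × ℕ) × (BinStr × ℕ)) =>
      ∀ y ∈ listOf q.2.1, FoundWithin c q.2.2 q.1.1 x y :=
    h1.forall_mem_list.comp (hl.comp Primrec.snd) Primrec.id
  have h3 : PrimrecPred fun q : (ℕ × ℕ) × (BinStr × ℕ) => ∀ x ∈ listOf q.2.1,
      ∀ y ∈ listOf q.2.1, FoundWithin c q.2.2 q.1.1 x y :=
    h2.forall_mem_list.comp hl Primrec.id
  refine PrimrecPred.and ?_ (PrimrecPred.and (primrecPred_nodup.comp hl) h3)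
  exact Primrec.eq.comp (Primrec.list_length.comp hl) (primrec_pow.comp (Primrec.const 2)
    (Primrec.nat_sub.comp (Primrec.fst.comp Primrec.fst) (Primrec.snd.comp Primrec.fst)))

theorem primrec_selected (c : Code) : Primrec₂ (selected c) := by
  refine primrec_greedy (primrecRel_codesCluster c) (R := SmallOverlap) ?_
  have h1 : PrimrecRel fun (x : BinStr) (l : List BinStr) => x ∈ l :=
    ((Primrec.eq (α := BinStr)).exists_mem_list.comp Primrec.snd Primrec.fst).of_eq
      fun q => by simp
  have h2 : Primrec₂ fun (l l' : List BinStr) => l.filter (· ∈ l') := h1.listFilter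
  exact Primrec.nat_lt.comp (Primrec.list_length.comp (h2.comp
    (primrec_listOf.comp (Primrec.fst.comp (Primrec.snd.comp Primrec.snd)))
    (primrec_listOf.comp (Primrec.fst.comp Primrec.fst))))
    (primrec_overlap.comp (Primrec.fst.comp Primrec.snd))

theorem primrecRel_coreTest (c : Code) : PrimrecRel (CoreTest c) := by
  have h1 : PrimrecRel fun (b : BinStr × ℕ) (q : ((ℕ × ℕ) × BinStr) × (BinStr × ℕ)) =>
      b.1 = q.2.1 :=
    Primrec.eq.comp (Primrec.fst.comp Primrec.fst)
      (Primrec.fst.comp (Primrec.snd.comp Primrec.snd))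
  have h2 : PrimrecRel fun (y : BinStr) (q : ((ℕ × ℕ) × BinStr) × (BinStr × ℕ)) =>
      FoundWithin c q.2.2 q.1.1.1 y q.1.2 :=
    (primrecPred_foundWithin c).comp
      (((Primrec.snd.comp (Primrec.snd.comp Primrec.snd)).pair
        (Primrec.fst.comp (Primrec.fst.comp (Primrec.fst.comp Primrec.snd)))).pair
        (Primrec.fst.pair (Primrec.snd.comp (Primrec.fst.comp Primrec.snd))))
  exact PrimrecPred.and
    (h1.exists_mem_list.comp ((primrec_selected c).comp (Primrec.fst.comp Primrec.fst)
      (Primrec.snd.comp Primrec.snd)) Primrec.id)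
    (h2.isHeavy (Primrec.fst.comp Primrec.fst) (Primrec.fst.comp Primrec.snd))

theorem primrecRel_petalTest (c : Code) : PrimrecRel (PetalTest c) := by
  have hl : Primrec fun q : ((ℕ × ℕ) × BinStr) × (BinStr × ℕ) => listOf q.1.2 :=
    primrec_listOf.comp (Primrec.snd.comp Primrec.fst)
  have h2 : PrimrecRel fun (y : BinStr) (q : ((ℕ × ℕ) × BinStr) × (BinStr × ℕ)) =>
      FoundWithin c q.2.2 q.1.1.1 q.2.1 y :=
    (primrecPred_foundWithin c).comp
      (((Primrec.snd.comp (Primrec.snd.comp Primrec.snd)).pair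
        (Primrec.fst.comp (Primrec.fst.comp (Primrec.fst.comp Primrec.snd)))).pair
        ((Primrec.fst.comp (Primrec.snd.comp Primrec.snd)).pair Primrec.fst))
  refine PrimrecPred.and (PrimrecPred.and ?_ (primrecPred_nodup.comp hl))
    (h2.isHeavy (Primrec.fst.comp Primrec.fst) (Primrec.snd.comp Primrec.fst))
  exact Primrec.eq.comp (Primrec.list_length.comp hl) (primrec_pow.comp (Primrec.const 2)
    (Primrec.nat_sub.comp (Primrec.fst.comp (Primrec.fst.comp Primrec.fst))
      (Primrec.snd.comp (Primrec.fst.comp Primrec.fst))))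

end Primrec

/-! ### Counting candidate cores and petals -/

theorem isHeavy_iff {s : ℕ × ℕ} {p : BinStr → Prop} [DecidablePred p] {z : BinStr}
    (hz : (listOf z).Nodup) :
    IsHeavy s p z ↔ overlap s ≤ ((listOf z).toFinset.filter p).card := by
  rw [IsHeavy, ← List.toFinset_card_of_nodup (hz.filter _), List.toFinset_filter]
  simp

section Select

variable {U : BinStr → BinStr →. BinStr} {c : Code} {m e : ℕ}

theorem mem_coreSet_spec (hc : ∀ p y x, x ∈ U p y ↔ encode x ∈ c.eval (encode (p, y)))
    {z : BinStr} (hz : z ∈ coreSet c (m, e)) :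
    (listOf z).length = 2 ^ (m - e) ∧ (listOf z).Nodup ∧
      ∀ x ∈ listOf z, ∀ y ∈ listOf z, condC U x y ≤ m := by
  obtain ⟨t, b, hb, rfl⟩ := hz
  obtain ⟨h1, h2, h3⟩ := (greedy_spec t).1 b hb
  exact ⟨h1, h2, fun x hx y hy => (exists_foundWithin_iff hc).1 ⟨_, h3 x hx y hy⟩⟩

/-- A symmetric form of `SmallOverlap`. -/
def SmallInter (s : ℕ × ℕ) (b a : BinStr × ℕ) : Prop :=
  ((listOf b.1).toFinset ∩ (listOf a.1).toFinset).card < overlap s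

instance (s : ℕ × ℕ) : Std.Symm (SmallInter s) where
  symm a b h := by rwa [SmallInter, Finset.inter_comm]

theorem card_inter_of_mem_coreSet {z z' : BinStr} (hz : z ∈ coreSet c (m, e))
    (hz' : z' ∈ coreSet c (m, e)) (hne : z ≠ z') :
    ((listOf z).toFinset ∩ (listOf z').toFinset).card < overlap (m, e) := by
  obtain ⟨t, b, hb, rfl⟩ := hz
  obtain ⟨t', b', hb', rfl⟩ := hz'
  replace hb := (greedy_prefix (le_max_left t t')).subset hb
  replace hb' := (greedy_prefix (le_max_right t t')).subset hb'
  have hs := greedy_spec (P := CodesCluster c (m, e)) (R := SmallOverlap (m, e)) (max t t')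
  have hp : (greedy (CodesCluster c (m, e)) (SmallOverlap (m, e)) (max t t')).Pairwise
      (SmallInter (m, e)) := by
    refine hs.2.imp_of_mem fun {b a} _ ha h => ?_
    rw [SmallOverlap, ← List.toFinset_card_of_nodup ((hs.1 a ha).2.1.filter _),
      List.toFinset_filter] at h
    rw [SmallInter, Finset.inter_comm, ← Finset.filter_mem_eq_inter]
    simpa using h
  exact hp.forall hb hb' fun h => hne (congrArg Prod.fst h)

theorem exists_mem_coreSet (hc : ∀ p y x, x ∈ U p y ↔ encode x ∈ c.eval (encode (p, y)))
    {S : Finset BinStr} (hS : S.card = 2 ^ (m - e)) (hm : ∀ x ∈ S, ∀ y ∈ S, condC U x y ≤ m) :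
    ∃ z ∈ coreSet c (m, e), overlap (m, e) ≤ ((listOf z).toFinset ∩ S).card := by
  obtain ⟨z, hz⟩ := exists_listOf_eq S.toList
  -- Finiteness of `S` gives one time bound for all pairs, so `S` itself becomes a candidate for
  -- selection.
  have hw : ∃ w, ∀ q ∈ S ×ˢ S, FoundWithin c w m q.1 q.2 := by
    have h : ∀ q : BinStr × BinStr, ∃ w, q ∈ S ×ˢ S → FoundWithin c w m q.1 q.2 := fun q => by
      by_cases hq : q ∈ S ×ˢ S
      · obtain ⟨h1, h2⟩ := Finset.mem_product.1 hq
        obtain ⟨w, hw⟩ := (exists_foundWithin_iff hc).2 (hm _ h1 _ h2)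
        exact ⟨w, fun _ => hw⟩
      · exact ⟨0, fun h => absurd h hq⟩
    choose w hw using h
    exact ⟨(S ×ˢ S).sup w, fun q hq => (hw q hq).mono (Finset.le_sup hq)⟩
  obtain ⟨w, hw⟩ := hw
  have ha : CodesCluster c (m, e) (z, w) := by
    refine ⟨by simp [hz, hS], by simp [hz, S.nodup_toList], fun x hx y hy => ?_⟩
    simp only [hz, Finset.mem_toList] at hx hy
    exact hw (x, y) (Finset.mk_mem_product hx hy)
  obtain ⟨t, b, hb, h⟩ := exists_mem_greedy (R := SmallOverlap (m, e)) ha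
  refine ⟨b.1, ⟨t, b, hb, rfl⟩, ?_⟩
  rcases h with rfl | h
  · simpa [hz, hS] using overlap_le m e
  · rw [SmallOverlap, not_lt] at h
    rw [Finset.inter_comm, ← Finset.filter_mem_eq_inter]
    refine h.trans_eq ?_
    rw [hz, ← List.toFinset_card_of_nodup (S.nodup_toList.filter _), List.toFinset_filter]
    simp

theorem card_lt_of_mem_coreSet (he : e ≤ m)
    (hc : ∀ p y x, x ∈ U p y ↔ encode x ∈ c.eval (encode (p, y))) {x : BinStr}
    {A : Finset BinStr} (hA : ∀ z ∈ A, z ∈ coreSet c (m, e) ∧ x ∈ listOf z) :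
    A.card < 2 ^ (e + 2) := by
  obtain ⟨B, hB, hcard⟩ := exists_finset_condC_le U m x
  refine card_lt_of_biUnion_subset (F := fun z => (listOf z).toFinset) (M := 2 ^ (m - e)) (B := B)
    (fun z hz => ?_) (fun z hz z' hz' hne => ?_) (fun z hz y hy => ?_) ?_
  · have h := mem_coreSet_spec hc (hA z hz).1
    rw [List.toFinset_card_of_nodup h.2.1, h.1]
  · exact mul_le_of_lt_overlap he (card_inter_of_mem_coreSet (hA z hz).1 (hA z' hz').1 hne)
  · exact hB y ((mem_coreSet_spec hc (hA z hz).1).2.2 y (List.mem_toFinset.1 hy) x (hA z hz).2)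
  -- `2 ^ (e + 2)` sets of size `2 ^ (m - e)` would cover at least half of `2 ^ (m + 2)`, more than
  -- the ball holds.
  · rw [← pow_add, show e + 2 + (m - e) = m + 1 + 1 by omega, pow_succ _ (m + 1)]
    omega

theorem card_le_of_coreTest (he : e ≤ m)
    (hc : ∀ p y x, x ∈ U p y ↔ encode x ∈ c.eval (encode (p, y))) {x : BinStr}
    {A : Finset BinStr} (hA : ∀ z ∈ A, ∃ w, CoreTest c ((m, e), x) (z, w)) :
    A.card ≤ 2 ^ (3 * e + 6) := by
  classical
  obtain ⟨B, hB, hcard⟩ := exists_finset_condC_le U m x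
  have hcore : ∀ z ∈ A, z ∈ coreSet c (m, e) := fun z hz => by
    obtain ⟨w, h, -⟩ := hA z hz
    exact ⟨w, h⟩
  -- Double counting of pairs `(z, y)` with `y` in the ball of `x` and in the set coded by `z`.
  have h : A.card * overlap (m, e) ≤ B.card * 2 ^ (e + 2) := by
    refine Finset.card_mul_le_card_mul (fun z y => y ∈ listOf z) (fun z hz => ?_) fun y _ => ?_
    · obtain ⟨w, -, hw⟩ := hA z hz
      rw [isHeavy_iff (mem_coreSet_spec hc (hcore z hz)).2.1] at hw
      refine hw.trans (Finset.card_le_card fun y hy => ?_)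
      simp only [Finset.mem_filter, List.mem_toFinset] at hy
      exact Finset.mem_filter.2 ⟨hB y ((exists_foundWithin_iff hc).1 ⟨_, hy.2⟩), hy.1⟩
    · refine (card_lt_of_mem_coreSet (x := y) he hc fun z hz => ?_).le
      exact ⟨hcore z (Finset.mem_filter.1 hz).1, (Finset.mem_filter.1 hz).2⟩
  refine Nat.le_of_mul_le_mul_right (c := 2 ^ m) ?_ (by positivity)
  calc A.card * 2 ^ m ≤ A.card * (2 ^ (2 * e + 3) * overlap (m, e)) := by
        gcongr; exact two_pow_le_mul_overlap m e
    _ = 2 ^ (2 * e + 3) * (A.card * overlap (m, e)) := by ring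
    _ ≤ 2 ^ (2 * e + 3) * (2 ^ (m + 1) * 2 ^ (e + 2)) := by gcongr 2 ^ (2 * e + 3) * ?_; exact h.trans (by gcongr)
    _ = 2 ^ (3 * e + 6) * 2 ^ m := by rw [← pow_add, ← pow_add, ← pow_add]; congr 1; ring

theorem card_le_of_petalTest (he : e ≤ m)
    (hc : ∀ p y x, x ∈ U p y ↔ encode x ∈ c.eval (encode (p, y))) {z : BinStr}
    {A : Finset BinStr} (hA : ∀ x ∈ A, ∃ w, PetalTest c ((m, e), z) (x, w)) :
    A.card ≤ 2 ^ (m + e + 4) := by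
  classical
  rcases A.eq_empty_or_nonempty with rfl | ⟨x₀, hx₀⟩
  · simp
  obtain ⟨-, ⟨hlen, hnd⟩, -⟩ := hA x₀ hx₀
  -- Double counting of pairs `(x, y)` with `y` in the set coded by `z` and `x` in the ball of `y`.
  -- Only the size of the coded set matters; `z` need not be selected.
  have h : A.card * overlap (m, e) ≤ (listOf z).toFinset.card * 2 ^ (m + 1) := by
    refine Finset.card_mul_le_card_mul (fun x y => condC U x y ≤ m) (fun x hx => ?_) fun y _ => ?_
    · obtain ⟨w, -, hw⟩ := hA x hx
      rw [isHeavy_iff hnd] at hw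
      refine hw.trans (Finset.card_le_card fun y hy => ?_)
      simp only [Finset.mem_filter] at hy
      exact Finset.mem_filter.2 ⟨hy.1, (exists_foundWithin_iff hc).1 ⟨_, hy.2⟩⟩
    · obtain ⟨B, hB, hcard⟩ := exists_finset_condC_le U m y
      refine (Finset.card_le_card fun x hx => ?_).trans hcard.le
      exact hB x (Finset.mem_filter.1 hx).2
  rw [List.toFinset_card_of_nodup hnd, hlen] at h
  refine Nat.le_of_mul_le_mul_right (c := 2 ^ m) ?_ (by positivity)
  calc A.card * 2 ^ m ≤ A.card * (2 ^ (2 * e + 3) * overlap (m, e)) := by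
        gcongr; exact two_pow_le_mul_overlap m e
    _ = 2 ^ (2 * e + 3) * (A.card * overlap (m, e)) := by ring
    _ ≤ 2 ^ (2 * e + 3) * (2 ^ (m - e) * 2 ^ (m + 1)) := by gcongr
    _ = 2 ^ (m + e + 4) * 2 ^ m := by
        rw [← pow_add, ← pow_add, ← pow_add]; congr 1; omega

/-- Existence of a core for a cluster of at least `2 ^ (m - e)` strings, with natural parameters. -/
theorem IsOptimal.exists_core (hU : IsOptimal U) :
    ∃ c : ℕ, ∀ (m e : ℕ) (S : Set BinStr), e ≤ m → ((2 ^ (m - e) : ℕ) : ℕ∞) ≤ S.encard →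
      (∀ x ∈ S, ∀ y ∈ S, condC U x y ≤ m) →
      ∃ z, ∀ x ∈ S, condC U z x ≤ ((4 * e + 2 * m.size + c : ℕ) : ℕ∞) ∧
        condC U x z ≤ m + ((4 * e + 2 * m.size + c : ℕ) : ℕ∞) := by
  classical
  obtain ⟨c, hc⟩ := exists_code_mem_iff hU.1
  obtain ⟨c₁, h₁⟩ := hU.exists_condC_le (primrecRel_coreTest c)
  obtain ⟨c₂, h₂⟩ := hU.exists_condC_le (primrecRel_petalTest c)
  refine ⟨c₁ + c₂ + 6, fun m e S he hS hm => ?_⟩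
  -- The core is found from a subset of the exact size; it serves all of `S`, since every `x` in `S`
  -- is close to every element of `S'`.
  obtain ⟨S', hsub, hcard⟩ := Set.exists_subset_encard_eq hS
  have hfin : S'.Finite := Set.finite_of_encard_eq_coe hcard
  lift S' to Finset BinStr using hfin
  rw [Set.encard_coe_eq_coe_finsetCard] at hcard
  replace hcard : S'.card = 2 ^ (m - e) := by exact_mod_cast hcard
  obtain ⟨z, hz, hov⟩ := exists_mem_coreSet hc hcard
    fun x hx y hy => hm x (hsub hx) y (hsub hy)
  obtain ⟨hlen, hnd, -⟩ := mem_coreSet_spec hc hz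
  refine ⟨z, fun x hx => ?_⟩
  -- A monotone property that each element of `S'` eventually acquires holds, from some time on, on
  -- the whole intersection of `S'` with the set coded by `z`.
  have heavy : ∀ p : ℕ → BinStr → Prop, (∀ y, ∀ w w', w ≤ w' → p w y → p w' y) →
      (∀ y ∈ S', ∃ w, p w y) → ∃ w, ∀ w' ≥ w, IsHeavy (m, e) (p w') z := by
    intro p hmono hp
    have h : ∀ y, ∃ w, y ∈ S' → p w y := fun y => by
      by_cases hy : y ∈ S'
      · exact (hp y hy).imp fun _ h _ => h
      · exact ⟨0, fun h => absurd h hy⟩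
    choose w hw using h
    refine ⟨S'.sup w, fun w' hw' => (isHeavy_iff hnd).2 (hov.trans (Finset.card_le_card ?_))⟩
    intro y hy
    obtain ⟨h1, h2⟩ := Finset.mem_inter.1 hy
    exact Finset.mem_filter.2 ⟨h1, hmono y _ _ ((Finset.le_sup h2).trans hw') (hw y h2)⟩
  constructor
  · obtain ⟨w, hw⟩ := heavy (fun w y => FoundWithin c w m y x) (fun _ _ _ h => .mono h)
      fun y hy => (exists_foundWithin_iff hc).2 (hm y (hsub hy) x hx)
    obtain ⟨t, b, hb, hbz⟩ := hz
    refine (h₁ m e (3 * e + 6) x (fun A hA => card_le_of_coreTest he hc hA) z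
      ⟨max t w, ⟨b, (greedy_prefix (le_max_left t w)).subset hb, hbz⟩,
        hw _ (le_max_right _ _)⟩).trans ?_
    norm_cast
    omega
  · obtain ⟨w, hw⟩ := heavy (fun w y => FoundWithin c w m x y) (fun _ _ _ h => .mono h)
      fun y hy => (exists_foundWithin_iff hc).2 (hm x hx y (hsub hy))
    refine (h₂ m e (m + e + 4) z (fun A hA => card_le_of_petalTest he hc hA) x
      ⟨w, ⟨hlen, hnd⟩, hw w le_rfl⟩).trans ?_
    norm_cast
    omega

end Select

/-! ### Real parameters -/

theorem natSize_le_logb (m : ℕ) : (m.size : ℝ) ≤ Real.logb 2 ((m : ℝ) + 2) + 1 := by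
  rcases Nat.eq_zero_or_pos m with rfl | hm
  · simp
  have h : 2 ^ (m.size - 1) ≤ m := Nat.lt_size.1 (Nat.sub_lt (Nat.size_pos.2 hm) one_pos)
  have h' : ((m.size - 1 : ℕ) : ℝ) ≤ Real.logb 2 ((m : ℝ) + 2) := by
    rw [Real.le_logb_iff_rpow_le one_lt_two (by positivity), Real.rpow_natCast]
    have : ((2 ^ (m.size - 1) : ℕ) : ℝ) ≤ m := by exact_mod_cast h
    push_cast at this
    linarith
  have h1 : m.size ≤ (m.size - 1) + 1 := by omega
  have h2 : (m.size : ℝ) ≤ ((m.size - 1 : ℕ) : ℝ) + 1 := by exact_mod_cast h1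
  linarith

theorem one_le_logb_add_two (m : ℕ) : 1 ≤ Real.logb 2 ((m : ℝ) + 2) := by
  rw [Real.le_logb_iff_rpow_le one_lt_two (by positivity), Real.rpow_one]
  linarith [(Nat.cast_nonneg m : (0 : ℝ) ≤ m)]

theorem four_le_three_mul_logb {m : ℕ} (hm : 1 ≤ m) : 4 ≤ 3 * Real.logb 2 ((m : ℝ) + 2) := by
  have hm' : (1 : ℝ) ≤ m := by exact_mod_cast hm
  have h : (4 / 3 : ℝ) ≤ Real.logb 2 3 := by
    -- `27 ≥ 16`.
    have h1 : (4 : ℝ) ≤ Real.logb 2 (3 ^ 3) := by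
      rw [Real.le_logb_iff_rpow_le one_lt_two (by positivity)]
      norm_num
    rw [Real.logb_pow] at h1
    push_cast at h1
    linarith
  have := Real.logb_le_logb_of_le one_lt_two (by norm_num : (0 : ℝ) < 3)
    (by linarith : (3 : ℝ) ≤ m + 2)
  linarith

/-- A negative `d` must not cancel the logarithm. For `m ≥ 1` three quarters of the logarithm is at
least `1 > -d`; at `m = 0` the logarithm is only `1`, whence the extra hypothesis. -/
theorem logb_le_four_mul {m : ℕ} {d : ℝ} (hd : -1 < d) (hd0 : m = 0 → 0 ≤ d) :
    Real.logb 2 ((m : ℝ) + 2) ≤ 4 * (d + Real.logb 2 ((m : ℝ) + 2)) := by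
  have h1 := one_le_logb_add_two m
  rcases Nat.eq_zero_or_pos m with hm | hm
  · linarith [hd0 hm]
  · linarith [four_le_three_mul_logb hm]

theorem natCeil_le_add_logb {m : ℕ} {d : ℝ} (hd : -1 < d) (hd0 : m = 0 → 0 ≤ d) :
    (⌈d⌉₊ : ℝ) ≤ d + Real.logb 2 ((m : ℝ) + 2) := by
  have h1 := one_le_logb_add_two m
  rcases le_or_gt 0 d with h | h
  · linarith [Nat.ceil_lt_add_one h]
  · rw [Nat.ceil_eq_zero.2 h.le]
    push_cast
    linarith [logb_le_four_mul hd hd0]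

theorem rpow_le_natCast_of_ennreal {r : ℝ} {n : ℕ} (h : (2 : ℝ≥0∞) ^ r ≤ (n : ℝ≥0∞)) :
    (2 : ℝ) ^ r ≤ n := by
  rw [← ENNReal.ofReal_natCast, ← ENNReal.ofReal_ofNat, ENNReal.ofReal_rpow_of_pos two_pos,
    ENNReal.ofReal_le_ofReal_iff (Nat.cast_nonneg n)] at h
  exact h

/-- A nonempty set of strings of small complexity given each other is finite, and its size bounds
the parameter `d` from below. -/
theorem exists_encard_eq {U : BinStr → BinStr →. BinStr} {m : ℕ} {d : ℝ} {S : Set BinStr}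
    (hm : ∀ x ∈ S, ∀ y ∈ S, condC U x y ≤ m)
    (hS : (2 : ℝ≥0∞) ^ ((m : ℝ) - d) ≤ (S.encard : ℝ≥0∞)) :
    ∃ n : ℕ, S.encard = n ∧ (2 : ℝ) ^ ((m : ℝ) - d) ≤ n ∧ n < 2 ^ (m + 1) := by
  have hne : S.Nonempty := by
    rw [Set.nonempty_iff_ne_empty]
    rintro rfl
    simp only [Set.encard_empty, ENat.toENNReal_zero, nonpos_iff_eq_zero] at hS
    exact (ENNReal.rpow_pos (by norm_num) (by norm_num)).ne' hS
  obtain ⟨x₀, hx₀⟩ := hne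
  obtain ⟨B, hB, hcard⟩ := exists_finset_condC_le U m x₀
  have hsub : S ⊆ B := fun x hx => hB x (hm x hx x₀ hx₀)
  have hfin := B.finite_toSet.subset hsub
  lift S to Finset BinStr using hfin
  refine ⟨S.card, Set.encard_coe_eq_coe_finsetCard S, ?_,
    (Finset.card_le_card (by exact_mod_cast hsub)).trans_lt hcard⟩
  rw [Set.encard_coe_eq_coe_finsetCard] at hS
  exact rpow_le_natCast_of_ennreal (by simpa using hS)

theorem IsOptimal.exists_core_real {U : BinStr → BinStr →. BinStr} (hU : IsOptimal U) :
    ∃ c : ℕ, ∀ (m : ℕ) (d : ℝ) (S : Set BinStr),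
      (∀ x ∈ S, ∀ x' ∈ S, condC U x x' ≤ m) →
      (2 : ℝ≥0∞) ^ ((m : ℝ) - d) ≤ (S.encard : ℝ≥0∞) →
      ∃ (z : BinStr) (k : ℕ), (k : ℝ) ≤ c * (d + Real.logb 2 ((m : ℝ) + 2)) ∧
        ∀ x ∈ S, condC U z x ≤ k ∧ condC U x z ≤ m + k := by
  obtain ⟨c, hc⟩ := hU.exists_core
  -- Put `L = log (m + 2)`. Then `4e ≤ 4 (d + L)`, `2 * m.size ≤ 2L + 2 ≤ 4L ≤ 16 (d + L)`, and `c ≤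
  -- 4c (d + L)` because `1 ≤ L`.
  refine ⟨20 + 4 * c, fun m d S hm hS => ?_⟩
  obtain ⟨n, hn, hlow, hup⟩ := exists_encard_eq hm hS
  have hd : -1 < d := by
    have h : (n : ℝ) < 2 ^ (m + 1) := by exact_mod_cast hup
    have h := hlow.trans_lt h
    rw [← Real.rpow_natCast, Real.rpow_lt_rpow_left_iff one_lt_two] at h
    push_cast at h
    linarith
  have hd0 : m = 0 → 0 ≤ d := by
    rintro rfl
    have h : (n : ℝ) ≤ 1 := by exact_mod_cast Nat.lt_succ_iff.1 hup
    have h := hlow.trans h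
    rw [← Real.rpow_zero 2, Real.rpow_le_rpow_left_iff one_lt_two] at h
    push_cast at h
    linarith
  -- Capping at `m` secures `e ≤ m`; when the cap is active, nonemptiness of `S` suffices.
  have hcard : ((2 ^ (m - min ⌈d⌉₊ m) : ℕ) : ℕ∞) ≤ S.encard := by
    rw [hn, Nat.cast_le]
    rcases le_total ⌈d⌉₊ m with h | h
    · rw [min_eq_left h]
      have h1 : (2 : ℝ) ^ ((m - ⌈d⌉₊ : ℕ) : ℝ) ≤ n := by
        refine (Real.rpow_le_rpow_of_exponent_le one_le_two ?_).trans hlow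
        rw [Nat.cast_sub h]
        linarith [Nat.le_ceil d]
      rw [Real.rpow_natCast] at h1
      exact_mod_cast h1
    · rw [min_eq_right h, Nat.sub_self, pow_zero]
      have : (0 : ℝ) < n := (Real.rpow_pos_of_pos two_pos _).trans_le hlow
      exact_mod_cast this
  obtain ⟨z, hz⟩ := hc m (min ⌈d⌉₊ m) S (min_le_right _ _) hcard hm
  refine ⟨z, _, ?_, hz⟩
  have h1 := one_le_logb_add_two m
  have h2 := logb_le_four_mul hd hd0
  have h3 := natCeil_le_add_logb hd hd0
  have h4 := natSize_le_logb m
  have h5 : ((min ⌈d⌉₊ m : ℕ) : ℝ) ≤ ⌈d⌉₊ := by exact_mod_cast min_le_left _ _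
  have h6 : (c : ℝ) * 1 ≤ c * (4 * (d + Real.logb 2 ((m : ℝ) + 2))) := by
    gcongr
    linarith
  generalize min ⌈d⌉₊ m = e at h5 ⊢
  push_cast
  linarith

theorem theorem1 (U : BinStr → BinStr →. BinStr) (hU : IsOptimal U) :
    (∃ c : ℕ, ∀ (m : ℕ) (d : ℝ) (S : Set BinStr),
      (∀ x ∈ S, ∀ x' ∈ S, condC U x x' ≤ m) →
      (2 : ℝ≥0∞) ^ ((m : ℝ) - d) ≤ (S.encard : ℝ≥0∞) →
      ∃ (z : BinStr) (k : ℕ), (k : ℝ) ≤ c * (d + Real.logb 2 ((m : ℝ) + 2)) ∧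
        ∀ x ∈ S, condC U z x ≤ k ∧ condC U x z ≤ m + k) ∧
    (∃ c : ℕ, ∀ (m : ℕ) (d : ℝ) (S : Set BinStr),
      IsCluster U m ((m : ℝ) - d) S →
      ∃ (z : BinStr) (m' d' : ℕ),
        (m' : ℝ) ≤ m + c * (d + Real.logb 2 ((m : ℝ) + 2)) ∧
        (d' : ℝ) ≤ c * (d + Real.logb 2 ((m : ℝ) + 2)) ∧
        S ⊆ daisy U m' d' z) := by
  obtain ⟨c, hc⟩ := hU.exists_core_real
  refine ⟨⟨c, hc⟩, c, fun m d S hS => ?_⟩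
  obtain ⟨z, k, hk, hz⟩ := hc m d S (fun x hx y hy => (le_max_left _ _).trans (hS.1 x hx y hy)) hS.2
  refine ⟨z, m, k, ?_, hk, hz⟩
  linarith [(Nat.cast_nonneg k : (0 : ℝ) ≤ k)]
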